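/- Let $\mathcal T$ be a triangulated category with suspension $\Sigma$ (for instance $\mathcal T=\mathrm{Ho}(\mathcal C)$ for a stable model category $\mathcal C$; an isomorphism in $\mathcal T$ is then the class of a weak equivalence). Let $f_\bullet:C_\bullet\to D_\bullet$ be a map of simplicial objects of $\mathcal T$, and let $C_*,D_*$ be the alternating sum complexes, with differentials $d^C,d^D$. *Totalizations.* A totalization of $C_\bullet$ is a sequence $0=\mathrm{Tot}(\mathcal F_{-1}C_*)\to \mathrm{Tot}(\mathcal F_0C_*)\to\mathrm{Tot}(\mathcal F_1C_*)\to\cdots$ with distinguished triangles $\mathrm{Tot}(\mathcal F_{m-1}C_*)\to\mathrm{Tot}(\mathcal F_{m}C_*)\to\Sigma^mC_m\xrightarrow{\partial_m}\Sigma\,\mathrm{Tot}(\mathcal F_{m-1}C_*)$ such that $\partial_{m+1}$ followed by $\Sigma\,\mathrm{Tot}(\mathcal F_{m}C_*)\to\Sigma\Sigma^{m}C_{m}$ is $\Sigma^{m+1}d^C_{m+1}$, together with its homotopy colimit $\mathrm{Tot}(C_*)$ (the cone of $1-\mathrm{shift}$ on $\bigoplus_m\mathrm{Tot}(\mathcal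 F_mC_*)$). Fix totalizations of $C_\bullet$ and $D_\bullet$. For $n\ge0$, $j\ge 0$ let $G^j_n(C)=\mathrm{Tot}(\mathcal F_{n+j-1}C_*/\mathcal F_{n-1}C_*)$, a cofiber of $\mathrm{Tot}(\mathcal F_{n-1}C_*)\to\mathrm{Tot}(\mathcal F_{n+j-1}C_*)$, be the part with cells in degrees $n,\dots,n+j-1$; by the octahedral axiom these objects can be and are arranged in a tower $0=G_n^0(C)\to G^1_n(C)\to G_n^2(C)\to\cdots$ with triangles $G^{j}_n(C)\to G^{j+1}_n(C)\to\Sigma^{n+j}C_{n+j}\xrightarrow{\partial}\Sigma G^{j}_n(C)$ compatible with those above. The same notation is used for $D$. A *filtration-preserving map* $G^k_n(C)\to G^k_n(D)$ *extending* $f_\bullet$ is a family $g^j:G^j_n(C)\to G^j_n(D)$, $0\le j\le k$, such that $(g^j,g^{j+1},\Sigma^{n+j}f_{n+j})$ is a morphism of triangles for every $0\le j<k$; filtration-preserving maps of the totalizations $\mathrm{Tot}(\mathcal F_m)$ are defined likewise, and a filtration-preserving map $\mathrm{Tot}(C_*)\to\mathrm{Tot}(D_*)$ is a map together with such a family on all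 $\mathrm{Tot}(\mathcal F_m)$, commuting with the maps $\mathrm{Tot}(\mathcal F_m)\to\mathrm{Tot}$. *Brackets.* A system of nulhomotopies in degrees $\ge n$ consists of successive choices as follows. One chooses maps $g^j:G^j_n(C)\to G^j_n(D)$, where $g^{j+1}$ is an extension of $g^{j}$ over the cell of degree $n+j$ (in the above sense) if there is one. For each $m\ge n$, with $j=m-n$, let $\delta_m=(\Sigma g^{j})\,\partial-\partial\,(\Sigma^mf_m):\Sigma^mC_m\to\Sigma G^{j}_n(D)$ be the defect of commutativity with the attaching maps; one chooses maps $\lambda_{m,i}:\Sigma^mC_m\to\Sigma\,G^{i-n}_n(D)$, with $\lambda_{m,m}=\delta_m$ and with $\lambda_{m,i}$, for $n<i<m$, a lift of $\lambda_{m,i+1}$ if there is one. For $N\ge1$, $i\ge n$ the bracket $T(N,i;f_\bullet):\Sigma^{N-1}C_{i+N}\to D_i$ of the system is the $(i+1)$-fold desuspension of the composite of $\lambda_{i+N,i+1}$ with the projection $\Sigma\,G^{i+1-n}_n(D)\to\Sigma\Sigma^iD_i$. Thus $\lambda_{i+N,i}$ is a nulhomotopy of $T(N,i;f_\bullet)$,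 and $T(N,i;f_\bullet)$ arises from a nulhomotopy $\lambda_{i+N,i+1}$ of $T(N-1,i+1;f_\bullet)$ and one of $T(N-1,i;f_\bullet)$ contained in $g^{i+N-n}$. The bracket $T(N,i;f_\bullet)$ is *defined* if all these choices could be made: the maps $g^j$, $0\le j\le i+N-n$, form a filtration-preserving map extending $f_\bullet$, and $\lambda_{i+N,j}$ is a lift of $\lambda_{i+N,j+1}$ for $i<j<i+N$. Brackets in a given range *vanish* if they are all zero for one and the same system. **Theorem.** 1. Let $n\ge 0$ and $k\ge3$. There is a filtration-preserving map $G_n^k(C)\to G^k_n(D)$ extending $f_\bullet$ if and only if the brackets $T(N,i;f_\bullet)$ with $2\le N<k$, $n\le i$, $N+i<n+k$ vanish (for some system in degrees $\ge n$). 2. If, for a system in degrees $\ge n$, the brackets $T(N,i;f_\bullet)$ with $2\le N<k$, $n\le i$ and $N+i\le n+k$ vanish, then its next bracket $T(k,n;f_\bullet):\Sigma^{k-1}C_{n+k}\to D_n$ is defined; it arises from the nulhomotopies of $T(k-1,n+1;f_\bullet)$ and $T(k-1,n;f_\bullet)$. 3. If there is a system in degrees $\ge0$ (for the towers $\mathrm{Tot}(\mathcal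 F_m)$) all of whose brackets $T(N,i;f_\bullet)$, $N\ge2$, $i\ge0$, vanish, then there is a filtration-preserving map $\mathrm{Tot}(C_*)\to\mathrm{Tot}(D_*)$ which is $\Sigma^mf_m$ on the $m$-th filtration quotient for each $m$. 4. If every $f_m$ is an isomorphism (a weak equivalence), then every filtration-preserving map $G_n^k(C)\to G_n^k(D)$ extending $f_\bullet$, and every filtration-preserving map of the $\mathrm{Tot}(\mathcal F_m)$ extending $f_\bullet$, is an isomorphism at each stage. -/

import Mathlib

open CategoryTheory CategoryTheory.Limits CategoryTheory.Pretriangulated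
open Opposite AlgebraicTopology
open scoped Simplicial

universe v u

namespace TotObstruction

noncomputable section

section

variable {𝒯 : Type u} [Category.{v} 𝒯] [HasZeroObject 𝒯] [HasShift 𝒯 ℤ] [Preadditive 𝒯]
  [∀ n : ℤ, (shiftFunctor 𝒯 n).Additive] [Pretriangulated 𝒯]

/-- The `m`-th cell `Σ^m K_m` of a complex `K` in the triangulated category. -/
abbrev cell (K : ChainComplex 𝒯 ℕ) (m : ℕ) : 𝒯 := (K.X m)⟦(m : ℤ)⟧

/-- The map `Σ^m φ_m` on cells. -/
abbrev cellMap {K L : ChainComplex 𝒯 ℕ} (φ : K ⟶ L) (m : ℕ) : cell K m ⟶ cell L m :=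
  (φ.f m)⟦(m : ℤ)⟧'

/-- The map `Σ^(m+1) d : Σ^(m+1) K_(m+1) ⟶ Σ (Σ^m K_m)`. -/
def cellDiff (K : ChainComplex 𝒯 ℕ) (m : ℕ) : cell K (m + 1) ⟶ (cell K m)⟦(1 : ℤ)⟧ :=
  (K.d (m + 1) m)⟦((m + 1 : ℕ) : ℤ)⟧' ≫
    (shiftFunctorAdd' 𝒯 (m : ℤ) 1 ((m + 1 : ℕ) : ℤ) (by push_cast; rfl)).hom.app (K.X m)

/-- A geometric realization tower with one cell `Σ^i K_i` for every `i ≥ n`: the object `obj m`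
is built from the cells `Σ^i K_i` with `n ≤ i < m`, it sits in distinguished triangles
`obj m ⟶ obj (m+1) ⟶ Σ^m K_m ⟶ Σ (obj m)`, and the attaching map of a cell, projected to the
cell just below, is the differential of `K`. Only the indices `m ≥ n` matter. -/
structure CellTower (K : ChainComplex 𝒯 ℕ) (n : ℕ) where
  obj : ℕ → 𝒯
  isZero : IsZero (obj n)
  incl (m : ℕ) : obj m ⟶ obj (m + 1)
  proj (m : ℕ) : obj (m + 1) ⟶ cell K m
  bd (m : ℕ) : cell K m ⟶ (obj m)⟦(1 : ℤ)⟧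
  dist (m : ℕ) (hm : n ≤ m) : Triangle.mk (incl m) (proj m) (bd m) ∈ distTriang 𝒯
  bd_proj (m : ℕ) (hm : n ≤ m) : bd (m + 1) ≫ (proj m)⟦(1 : ℤ)⟧' = cellDiff K m

/-- The composite `obj a ⟶ obj b` of the maps of the tower, for `a ≤ b`. -/
def CellTower.map {K : ChainComplex 𝒯 ℕ} {n : ℕ} (T : CellTower K n) {a b : ℕ} (h : a ≤ b) :
    T.obj a ⟶ T.obj b :=
  (Functor.ofSequence T.incl).map (homOfLE h)

/-- A totalization of a simplicial object `C` of the triangulated category: a tower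
`0 = Tot F_{-1} ⟶ Tot F_0 ⟶ Tot F_1 ⟶ ⋯` over the alternating sum complex of `C`
(`tower.obj m` is `Tot F_{m-1}`) together with its homotopy colimit `tot`, that is, a
distinguished triangle `⨁ Tot F_m ⟶ ⨁ Tot F_m ⟶ tot ⟶` whose first map is `1 - shift`. -/
structure Totalization (C : SimplicialObject 𝒯) where
  tower : CellTower ((alternatingFaceMapComplex 𝒯).obj C) 0
  sum : Cofan tower.obj
  isColimit : IsColimit sum
  tot : 𝒯
  fromSum : sum.pt ⟶ tot
  conn : tot ⟶ sum.pt⟦(1 : ℤ)⟧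
  dist : Triangle.mk
    (𝟙 sum.pt - Cofan.IsColimit.desc isColimit (fun m => tower.incl m ≫ sum.inj (m + 1)))
    fromSum conn ∈ distTriang 𝒯

/-- The map `Tot F_{m-1} ⟶ Tot` from a stage of the filtration to the homotopy colimit. -/
def Totalization.ι {C : SimplicialObject 𝒯} (T : Totalization C) (m : ℕ) :
    T.tower.obj m ⟶ T.tot :=
  T.sum.inj m ≫ T.fromSum

/-- The filtered subquotients of a tower with all cells of degree at least `n`: `obj m` is a
cofiber of `T.obj n ⟶ T.obj m` for `m ≥ n`, thus the totalization of the part of the complex in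
degrees `n, …, m - 1`. The maps between these cofibers and the triangles containing them are those
of the octahedral axiom for `T.obj n ⟶ T.obj m ⟶ T.obj (m+1)`. -/
structure GrTower {K : ChainComplex 𝒯 ℕ} (T : CellTower K 0) (n : ℕ) extends CellTower K n where
  quot (m : ℕ) : T.obj m ⟶ obj m
  conn (m : ℕ) : obj m ⟶ (T.obj n)⟦(1 : ℤ)⟧
  quot_dist (m : ℕ) (hm : n ≤ m) :
    Triangle.mk (T.map hm) (quot m) (conn m) ∈ distTriang 𝒯
  quot_incl (m : ℕ) (hm : n ≤ m) : quot m ≫ incl m = T.incl m ≫ quot (m + 1)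
  incl_conn (m : ℕ) (hm : n ≤ m) : incl m ≫ conn (m + 1) = conn m
  quot_proj (m : ℕ) (hm : n ≤ m) : quot (m + 1) ≫ proj m = T.proj m
  conn_map (m : ℕ) (hm : n ≤ m) : conn (m + 1) ≫ (T.map hm)⟦(1 : ℤ)⟧' = proj m ≫ T.bd m
  bd_quot (m : ℕ) (hm : n ≤ m) : T.bd m ≫ (quot m)⟦(1 : ℤ)⟧' = bd m

/-- By the octahedral axiom, the filtered subquotients of a tower exist. -/
theorem GrTower.nonempty [IsTriangulated 𝒯] {K : ChainComplex 𝒯 ℕ} (T : CellTower K 0) (n : ℕ) :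
    Nonempty (GrTower T n) := by
  classical
  have H : ∀ m, ∃ (Z : 𝒯) (q : T.obj m ⟶ Z) (c : Z ⟶ (T.obj n)⟦(1 : ℤ)⟧),
      ∀ h : n ≤ m, Triangle.mk (T.map h) q c ∈ distTriang 𝒯 := by
    intro m
    by_cases h : n ≤ m
    · obtain ⟨Z, q, c, d⟩ := Pretriangulated.distinguished_cocone_triangle (T.map h)
      exact ⟨Z, q, c, fun _ => d⟩
    · exact ⟨T.obj m, 0, 0, fun h' => (h h').elim⟩
  choose Z q c d using H
  have hmap (m : ℕ) (h : n ≤ m) : T.map h ≫ T.incl m = T.map (h.trans (Nat.le_succ m)) := by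
    have h1 : T.incl m = T.map (Nat.le_succ m) :=
      (Functor.ofSequence_map_homOfLE_succ T.incl m).symm
    rw [h1]
    exact ((Functor.ofSequence T.incl).map_comp (homOfLE h) (homOfLE (Nat.le_succ m))).symm
  have hO (m : ℕ) (h : n ≤ m) : Nonempty (Triangulated.Octahedron (hmap m h) (d m h)
      (T.dist m (Nat.zero_le m)) (d (m + 1) (h.trans (Nat.le_succ m)))) :=
    IsTriangulated.octahedron_axiom _ _ _ _
  have O (m : ℕ) (h : n ≤ m) := (hO m h).some
  have hz : IsZero (Z n) := by
    have h1 : T.map (le_refl n) = 𝟙 _ := (Functor.ofSequence T.incl).map_id n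
    refine (Triangle.isZero₃_iff_isIso₁ _ (d n le_rfl)).2 ?_
    change IsIso (T.map (le_refl n))
    rw [h1]
    infer_instance
  refine ⟨{ obj := Z, isZero := hz, quot := q, conn := c, quot_dist := d
            incl := fun m => if h : n ≤ m then (O m h).m₁ else 0
            proj := fun m => if h : n ≤ m then (O m h).m₃ else 0
            bd := fun m => T.bd m ≫ (q m)⟦(1 : ℤ)⟧'
            dist := ?_, bd_proj := ?_, quot_incl := ?_, incl_conn := ?_, quot_proj := ?_
            conn_map := ?_, bd_quot := fun _ _ => rfl }⟩
  · intro m h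
    rw [dif_pos h, dif_pos h]
    exact (O m h).mem
  · intro m h
    rw [dif_pos h, Category.assoc, ← Functor.map_comp, (O m h).comm₃]
    exact T.bd_proj m (Nat.zero_le m)
  · intro m h
    rw [dif_pos h]
    exact (O m h).comm₁
  · intro m h
    rw [dif_pos h]
    exact (O m h).comm₂
  · intro m h
    rw [dif_pos h]
    exact (O m h).comm₃
  · intro m h
    rw [dif_pos h]
    exact (O m h).comm₄

section Maps

variable {K L : ChainComplex 𝒯 ℕ} (φ : K ⟶ L) {n : ℕ} (A : CellTower K n) (B : CellTower L n)

/-- `b` extends `a` over the `m`-th cell, where it is `Σ^m φ_m`: the three maps `a`, `b` and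
`Σ^m φ_m` form a morphism of distinguished triangles. -/
def IsExtension (m : ℕ) (a : A.obj m ⟶ B.obj m) (b : A.obj (m + 1) ⟶ B.obj (m + 1)) : Prop :=
  A.incl m ≫ b = a ≫ B.incl m ∧
  A.proj m ≫ cellMap φ m = b ≫ B.proj m ∧
  A.bd m ≫ a⟦(1 : ℤ)⟧' = cellMap φ m ≫ B.bd m

/-- The maps `g m`, for `n ≤ m ≤ b`, form a filtration-preserving map `A.obj b ⟶ B.obj b` which on
the filtration quotients `Σ^m K_m ⟶ Σ^m L_m`, for `n ≤ m < b`, is given by `φ_m`. -/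
def IsFilteredMap (g : ∀ m, A.obj m ⟶ B.obj m) (b : ℕ) : Prop :=
  ∀ m, n ≤ m → m < b → IsExtension φ A B m (g m) (g (m + 1))

/-- The difference of the two composites in the square formed by the attaching maps of the `m`-th
cells, `Σ^m φ_m` and `g m`. -/
def attachingDefect (g : ∀ m, A.obj m ⟶ B.obj m) (m : ℕ) : cell K m ⟶ (B.obj m)⟦(1 : ℤ)⟧ :=
  A.bd m ≫ (g m)⟦(1 : ℤ)⟧' - cellMap φ m ≫ B.bd m

/-- The data of successive choices of nulhomotopies: maps `ext m` between the stages of the towers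
and, for every `m`, maps `lift m j` from the `m`-th cell to the (suspended) stages of the second
tower. The conditions on them are stated in `NullhomotopySystem`. -/
structure NullhomotopyData where
  ext (m : ℕ) : A.obj m ⟶ B.obj m
  lift (m j : ℕ) : cell K m ⟶ (B.obj j)⟦(1 : ℤ)⟧

variable {A B}

/-- The Toda bracket `T(N,i) : Σ^(N-1) K_(i+N) ⟶ L_i`: the map whose `(i+1)`-st suspension is the
composite `Σ^(i+N) K_(i+N) ⟶ Σ (B.obj (i+1)) ⟶ Σ (Σ^i L_i)` of `lift (i+N) (i+1)` and the
projection to the top cell. -/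
def NullhomotopyData.toda (S : NullhomotopyData A B) (N i : ℕ) :
    (K.X (i + N))⟦(N : ℤ) - 1⟧ ⟶ L.X i :=
  (shiftFunctor 𝒯 ((i : ℤ) + 1)).preimage
    ((shiftFunctorAdd' 𝒯 ((N : ℤ) - 1) ((i : ℤ) + 1) ((i + N : ℕ) : ℤ)
        (by push_cast; ring)).inv.app (K.X (i + N)) ≫
      S.lift (i + N) (i + 1) ≫ (B.proj i)⟦(1 : ℤ)⟧' ≫
      (shiftFunctorAdd' 𝒯 (i : ℤ) 1 ((i : ℤ) + 1) rfl).inv.app (L.X i))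

variable (A B)

/-- A system of choices of nulhomotopies for a map `φ` of complexes, in degrees at least `n`.

* `lift m m` is the attaching defect of `ext m`, the obstruction to extending `ext m` over the
  `m`-th cell, and `ext (m+1)` is such an extension if there is one.
* The map `lift (i+N) (i+1)` represents `T(N,i)`. A nulhomotopy of `T(N,i)` is a lift of this map
  along `Σ (B.obj i) ⟶ Σ (B.obj (i+1))`, the fiber of the projection to `Σ (Σ^i L_i)`; the map
  `lift (i+N) i` is such a lift if there is one.

So `T(N,i)` arises from a nulhomotopy of `T(N-1,i+1)`, recorded by `lift (i+N) (i+1)`, and from one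
of `T(N-1,i)`, recorded by `ext (i+N)`; and `T(1,i)` is the class of `φ d - d φ`, which is zero.
Such systems always exist: where no choice is possible, no condition is imposed, and the brackets
depending on that choice are not defined in the sense of `NullhomotopySystem.IsDefined`. -/
structure NullhomotopySystem extends NullhomotopyData A B where
  lift_self (m : ℕ) (hm : n ≤ m) : lift m m = attachingDefect φ A B ext m
  lift_spec (m j : ℕ) (hj : n < j) (hm : j < m)
    (h : ∃ l : cell K m ⟶ (B.obj j)⟦(1 : ℤ)⟧, l ≫ (B.incl j)⟦(1 : ℤ)⟧' = lift m (j + 1)) :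
    lift m j ≫ (B.incl j)⟦(1 : ℤ)⟧' = lift m (j + 1)
  ext_spec (m : ℕ) (hm : n ≤ m) (h : ∃ b, IsExtension φ A B m (ext m) b) :
    IsExtension φ A B m (ext m) (ext (m + 1))

variable {φ A B}

/-- `T(N,i)` is defined: all nulhomotopies that enter into it have been found. These are
the maps `ext` up to the stage `i + N` and the successive lifts of the attaching defect of
`ext (i+N)` to `Σ (B.obj (i+1))`. -/
def NullhomotopySystem.IsDefined (S : NullhomotopySystem φ A B) (N i : ℕ) : Prop :=
  IsFilteredMap φ A B S.ext (i + N) ∧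
  ∀ j, i < j → j < i + N →
    S.lift (i + N) j ≫ (B.incl j)⟦(1 : ℤ)⟧' = S.lift (i + N) (j + 1)

end Maps

end

end

end TotObstruction

open TotObstruction

/-!
A map between the `m`-th stages extends over the `m`-th cell if and only if its attaching defect
`Σ^m K_m ⟶ Σ (B.obj m)` is zero. The projection of the defect to the cell just below is
`φ d - d φ = 0`, so the defect lifts to the stage below. By exactness, a lift to `Σ (B.obj (i + 1))`
lifts further to `Σ (B.obj i)` if and only if its projection to the `i`-th cell, which is a bracket,
is zero. If all these brackets vanish, then the defect factors through `Σ (B.obj n) = 0` and so is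
itself zero. Conversely, along a filtered map all defects are zero, and zero nulhomotopies may be
chosen. The map of homotopy colimits comes from a morphism of the triangles on `1 - shift`, and the
statement on isomorphisms is the five lemma for the triangles of the towers.
-/

namespace TotObstruction

theorem exists_choice_extending {α β : Type*} (P : α → β → Prop) (a₀ : α) (b₀ : β) :
    ∃ c : α → β, (P a₀ b₀ → c a₀ = b₀) ∧ ∀ a, (∃ b, P a b) → P a (c a) := by
  have h (a : α) : ∃ b, (a = a₀ → P a₀ b₀ → b = b₀) ∧ ((∃ b, P a b) → P a b) := by
    by_cases h₀ : a = a₀ ∧ P a₀ b₀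
    · exact ⟨b₀, fun _ _ => rfl, fun _ => h₀.1 ▸ h₀.2⟩
    · by_cases hP : ∃ b, P a b
      · exact hP.imp fun b hb => ⟨fun ha hP₀ => (h₀ ⟨ha, hP₀⟩).elim, fun _ => hb⟩
      · exact ⟨b₀, fun _ _ => rfl, fun hP' => (hP hP').elim⟩
  choose c hc₀ hc using h
  exact ⟨c, hc₀ a₀ rfl, hc⟩

theorem exists_descending_sequence {X : ℕ → Type*} [∀ j, Nonempty (X j)]
    (c : ∀ j, X (j + 1) → X j) {m : ℕ} (x : X m) :
    ∃ f : ∀ j, X j, f m = x ∧ ∀ j < m, f j = c j (f (j + 1)) := by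
  refine ⟨fun j => if h : j ≤ m then
    Nat.decreasingInduction (motive := fun j _ => X j) (fun j _ => c j) x h
    else Classical.arbitrary _, ?_, fun j hj => ?_⟩
  · beta_reduce
    rw [dif_pos le_rfl, Nat.decreasingInduction_self]
  · beta_reduce
    rw [dif_pos hj.le, dif_pos (Nat.succ_le_of_lt hj), Nat.decreasingInduction_succ_left]

section Coproducts

variable {𝒯 : Type u} [Category.{v} 𝒯] {X Y : ℕ → 𝒯}

/-- The endomorphism `shift` of `⨁ X_m` induced by a sequence `X_0 ⟶ X_1 ⟶ ⋯`. The coproduct is an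
arbitrary colimit cofan, as in `Totalization`. -/
def coproductShift {c : Cofan X} (hc : IsColimit c) (u : ∀ m, X m ⟶ X (m + 1)) : c.pt ⟶ c.pt :=
  Cofan.IsColimit.desc hc fun m => u m ≫ c.inj (m + 1)

theorem inj_comp_coproductShift {c : Cofan X} (hc : IsColimit c) (u : ∀ m, X m ⟶ X (m + 1))
    (m : ℕ) : c.inj m ≫ coproductShift hc u = u m ≫ c.inj (m + 1) :=
  Cofan.IsColimit.fac hc _ m

theorem coproductShift_naturality {c : Cofan X} (hc : IsColimit c) {d : Cofan Y}
    (hd : IsColimit d) {u : ∀ m, X m ⟶ X (m + 1)} {v : ∀ m, Y m ⟶ Y (m + 1)}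
    {g : ∀ m, X m ⟶ Y m} (hg : ∀ m, u m ≫ g (m + 1) = g m ≫ v m)
    {s : c.pt ⟶ d.pt} (hs : ∀ m, c.inj m ≫ s = g m ≫ d.inj m) :
    coproductShift hc u ≫ s = s ≫ coproductShift hd v := by
  refine Cofan.IsColimit.hom_ext hc _ _ fun m => ?_
  calc
    c.inj m ≫ coproductShift hc u ≫ s = (u m ≫ g (m + 1)) ≫ d.inj (m + 1) := by
      rw [← Category.assoc, inj_comp_coproductShift, Category.assoc, hs, Category.assoc]
    _ = g m ≫ v m ≫ d.inj (m + 1) := by rw [hg, Category.assoc]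
    _ = c.inj m ≫ s ≫ coproductShift hd v := by
      rw [← inj_comp_coproductShift hd, reassoc_of% hs]

end Coproducts

theorem cellDiff_naturality {𝒯 : Type u} [Category.{v} 𝒯] [HasShift 𝒯 ℤ] [Preadditive 𝒯]
    {K L : ChainComplex 𝒯 ℕ} (φ : K ⟶ L) (m : ℕ) :
    cellDiff K m ≫ (cellMap φ m)⟦(1 : ℤ)⟧' = cellMap φ (m + 1) ≫ cellDiff L m := by
  have shift_naturality :=
    (shiftFunctorAdd' 𝒯 (m : ℤ) 1 ((m + 1 : ℕ) : ℤ) (by push_cast; rfl)).hom.naturality (φ.f m)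
  dsimp only [Functor.comp_map] at shift_naturality
  rw [cellDiff, cellDiff, Category.assoc, ← shift_naturality, ← Category.assoc, ← Category.assoc,
    ← Functor.map_comp, ← Functor.map_comp, φ.comm]

section Pretriangulated

variable {𝒯 : Type u} [Category.{v} 𝒯] [HasZeroObject 𝒯] [HasShift 𝒯 ℤ] [Preadditive 𝒯]
  [∀ n : ℤ, (shiftFunctor 𝒯 n).Additive] [Pretriangulated 𝒯]

theorem exists_lift_shift_iff {T : Triangle 𝒯} (hT : T ∈ distTriang 𝒯) (n : ℤ) {W : 𝒯}
    (l : W ⟶ T.obj₂⟦n⟧) :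
    (∃ l' : W ⟶ T.obj₁⟦n⟧, l' ≫ T.mor₁⟦n⟧' = l) ↔ l ≫ T.mor₂⟦n⟧' = 0 := by
  constructor
  · rintro ⟨l', rfl⟩
    rw [Category.assoc, ← Functor.map_comp, comp_distTriang_mor_zero₁₂ T hT, Functor.map_zero,
      comp_zero]
  · intro hl
    obtain ⟨(l' : W ⟶ T.obj₁⟦n⟧), (hl' : l = l' ≫ (n.negOnePow • T.mor₁⟦n⟧'))⟩ :=
      Triangle.coyoneda_exact₂ _ (Triangle.shift_distinguished T hT n) l (by
        change l ≫ (n.negOnePow • T.mor₂⟦n⟧') = 0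
        rw [Linear.comp_units_smul, hl, smul_zero])
    exact ⟨n.negOnePow • l', by rw [hl', Linear.units_smul_comp, Linear.comp_units_smul]⟩

/-- A homotopy colimit of a sequence `X_0 ⟶ X_1 ⟶ ⋯`: a cofiber of `1 - shift` on `⨁ X_m`. It
isolates the part of a `Totalization` that does not involve the cells. -/
structure HomotopyColimit {X : ℕ → 𝒯} (u : ∀ m, X m ⟶ X (m + 1)) where
  sum : Cofan X
  isColimit : IsColimit sum
  pt : 𝒯
  fromSum : sum.pt ⟶ pt
  conn : pt ⟶ sum.pt⟦(1 : ℤ)⟧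
  dist : Triangle.mk (𝟙 sum.pt - coproductShift isColimit u) fromSum conn ∈ distTriang 𝒯

namespace HomotopyColimit

variable {X Y : ℕ → 𝒯} {u : ∀ m, X m ⟶ X (m + 1)} {v : ∀ m, Y m ⟶ Y (m + 1)}

/-- The canonical map to the homotopy colimit from the `m`-th term of the sequence. -/
def ι (H : HomotopyColimit u) (m : ℕ) : X m ⟶ H.pt :=
  H.sum.inj m ≫ H.fromSum

theorem exists_map (H : HomotopyColimit u) (H' : HomotopyColimit v) (g : ∀ m, X m ⟶ Y m)
    (hg : ∀ m, u m ≫ g (m + 1) = g m ≫ v m) :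
    ∃ G : H.pt ⟶ H'.pt, ∀ m, H.ι m ≫ G = g m ≫ H'.ι m := by
  let s : H.sum.pt ⟶ H'.sum.pt := Cofan.IsColimit.desc H.isColimit fun m => g m ≫ H'.sum.inj m
  have hs (m : ℕ) : H.sum.inj m ≫ s = g m ≫ H'.sum.inj m := Cofan.IsColimit.fac _ _ _
  have comm : (𝟙 _ - coproductShift H.isColimit u) ≫ s =
      s ≫ (𝟙 _ - coproductShift H'.isColimit v) := by
    rw [Preadditive.sub_comp, Preadditive.comp_sub, Category.id_comp, Category.comp_id,
      coproductShift_naturality H.isColimit H'.isColimit hg hs]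
  obtain ⟨(G : H.pt ⟶ H'.pt), (hG : H.fromSum ≫ G = s ≫ H'.fromSum), -⟩ :=
    complete_distinguished_triangle_morphism _ _ H.dist H'.dist s s comm
  exact ⟨G, fun m => by rw [ι, ι, Category.assoc, hG, reassoc_of% hs]⟩

end HomotopyColimit

/-- The homotopy colimit that is part of a totalization. -/
def Totalization.homotopyColimit {C : SimplicialObject 𝒯} (T : Totalization C) :
    HomotopyColimit T.tower.incl where
  sum := T.sum
  isColimit := T.isColimit
  pt := T.tot
  fromSum := T.fromSum
  conn := T.conn
  dist := T.dist

section Maps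

variable {K L : ChainComplex 𝒯 ℕ} {φ : K ⟶ L} {n : ℕ} {A : CellTower K n} {B : CellTower L n}

theorem exists_isExtension_iff (g : ∀ m, A.obj m ⟶ B.obj m) {m : ℕ} (hm : n ≤ m) :
    (∃ b, IsExtension φ A B m (g m) b) ↔ attachingDefect φ A B g m = 0 := by
  rw [attachingDefect, sub_eq_zero]
  constructor
  · rintro ⟨b, -, -, hbd⟩
    exact hbd
  · intro hbd
    obtain ⟨b, hincl, hproj⟩ := complete_distinguished_triangle_morphism₂ _ _ (A.dist m hm)
      (B.dist m hm) (g m) (cellMap φ m) hbd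
    exact ⟨b, hincl, hproj, hbd⟩

theorem attachingDefect_comp_proj {g : ∀ m, A.obj m ⟶ B.obj m} {m : ℕ} (hm : n ≤ m)
    (hproj : A.proj m ≫ cellMap φ m = g (m + 1) ≫ B.proj m) :
    attachingDefect φ A B g (m + 1) ≫ (B.proj m)⟦(1 : ℤ)⟧' = 0 := by
  rw [attachingDefect, Preadditive.sub_comp, sub_eq_zero]
  calc
    (A.bd (m + 1) ≫ (g (m + 1))⟦(1 : ℤ)⟧') ≫ (B.proj m)⟦(1 : ℤ)⟧' =
        (A.bd (m + 1) ≫ (A.proj m)⟦(1 : ℤ)⟧') ≫ (cellMap φ m)⟦(1 : ℤ)⟧' := by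
      rw [Category.assoc, Category.assoc, ← Functor.map_comp, ← Functor.map_comp, hproj]
    _ = cellMap φ (m + 1) ≫ cellDiff L m := by rw [A.bd_proj m hm, cellDiff_naturality]
    _ = (cellMap φ (m + 1) ≫ B.bd (m + 1)) ≫ (B.proj m)⟦(1 : ℤ)⟧' := by
      rw [Category.assoc, B.bd_proj m hm]

theorem NullhomotopyData.toda_eq_zero_iff (S : NullhomotopyData A B) (N i : ℕ) :
    S.toda N i = 0 ↔ S.lift (i + N) (i + 1) ≫ (B.proj i)⟦(1 : ℤ)⟧' = 0 := by
  rw [toda, ← (shiftFunctor 𝒯 ((i : ℤ) + 1)).map_eq_zero_iff, Functor.map_preimage,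
    Preadditive.IsIso.comp_left_eq_zero, ← Category.assoc, Preadditive.IsIso.comp_right_eq_zero]

theorem NullhomotopyData.toda_eq_zero_iff_exists_lift (S : NullhomotopyData A B) (N : ℕ) {i : ℕ}
    (hi : n ≤ i) :
    S.toda N i = 0 ↔ ∃ l : cell K (i + N) ⟶ (B.obj i)⟦(1 : ℤ)⟧,
      l ≫ (B.incl i)⟦(1 : ℤ)⟧' = S.lift (i + N) (i + 1) := by
  rw [S.toda_eq_zero_iff]
  exact (exists_lift_shift_iff (B.dist i hi) 1 _).symm

namespace NullhomotopySystem

variable (S : NullhomotopySystem φ A B)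

theorem toda_one_eq_zero {i : ℕ} (hi : n ≤ i)
    (hS : IsExtension φ A B i (S.ext i) (S.ext (i + 1))) : S.toda 1 i = 0 := by
  rw [NullhomotopyData.toda_eq_zero_iff, S.lift_self (i + 1) (by omega)]
  exact attachingDefect_comp_proj hi hS.2.1

theorem lift_comp_incl {N i : ℕ} (hN : 1 ≤ N) (hi : n < i) (h : S.toda N i = 0) :
    S.lift (i + N) i ≫ (B.incl i)⟦(1 : ℤ)⟧' = S.lift (i + N) (i + 1) :=
  S.lift_spec _ i hi (by omega) ((S.toda_eq_zero_iff_exists_lift N hi.le).1 h)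

theorem lift_eq_zero {m : ℕ} (h : ∀ N i, 1 ≤ N → n ≤ i → i + N = m → S.toda N i = 0) {j : ℕ}
    (hj : n < j) (hjm : j ≤ m) : S.lift m j = 0 := by
  induction j, hj using Nat.le_induction with
  | base =>
    obtain ⟨N, rfl⟩ := Nat.exists_eq_add_of_le (Nat.le_of_succ_le hjm)
    obtain ⟨l, hl⟩ := (S.toda_eq_zero_iff_exists_lift N le_rfl).1 (h N n (by omega) le_rfl rfl)
    have hl₀ : l = 0 := ((shiftFunctor 𝒯 (1 : ℤ)).map_isZero B.isZero).eq_of_tgt _ _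
    rw [← hl, hl₀, zero_comp]
  | succ j hj ih =>
    obtain ⟨N, rfl⟩ := Nat.exists_eq_add_of_le (Nat.le_of_succ_le hjm)
    have hN : 1 ≤ N := by omega
    rw [← S.lift_comp_incl hN hj (h N j hN (by omega) rfl), ih (by omega), zero_comp]

theorem isExtension {m : ℕ} (hm : n ≤ m)
    (h : ∀ N i, 1 ≤ N → n ≤ i → i + N = m → S.toda N i = 0) :
    IsExtension φ A B m (S.ext m) (S.ext (m + 1)) := by
  refine S.ext_spec m hm ((exists_isExtension_iff _ hm).2 ?_)
  obtain rfl | hm' := hm.eq_or_lt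
  · exact ((shiftFunctor 𝒯 (1 : ℤ)).map_isZero B.isZero).eq_of_tgt _ _
  · rw [← S.lift_self m hm, S.lift_eq_zero h hm' le_rfl]

theorem isFilteredMap {b : ℕ} (h : ∀ N i, 2 ≤ N → n ≤ i → i + N < b → S.toda N i = 0) :
    IsFilteredMap φ A B S.ext b := by
  intro m hm
  induction m using Nat.strong_induction_on with
  | _ m ih =>
    intro hmb
    refine S.isExtension hm fun N i hN hi hiN => ?_
    obtain rfl | hN := hN.eq_or_lt
    · exact S.toda_one_eq_zero hi (ih i (by omega) hi (by omega))
    · exact h N i hN hi (by omega)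

theorem isDefined {N i : ℕ} (hi : n ≤ i)
    (hstage : ∀ M j, 2 ≤ M → n ≤ j → j + M < i + N → S.toda M j = 0)
    (hcell : ∀ M j, 2 ≤ M → i < j → j + M = i + N → S.toda M j = 0) : S.IsDefined N i := by
  have hS := S.isFilteredMap hstage
  refine ⟨hS, fun j hij hj => ?_⟩
  obtain ⟨M, hM⟩ := Nat.exists_eq_add_of_le hj.le
  rw [hM]
  refine S.lift_comp_incl (by omega) (by omega) ?_
  obtain rfl | hM' : M = 1 ∨ 2 ≤ M := by omega
  · exact S.toda_one_eq_zero (by omega) (hS j (by omega) hj)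
  · exact hcell M j hM' hij hM.symm

end NullhomotopySystem

theorem CellTower.exists_iterated_lift (B : CellTower L n) {W : 𝒯} {m : ℕ}
    (x : W ⟶ (B.obj m)⟦(1 : ℤ)⟧) :
    ∃ l : ∀ j, W ⟶ (B.obj j)⟦(1 : ℤ)⟧, l m = x ∧
      (∀ j < m, (∃ l', l' ≫ (B.incl j)⟦(1 : ℤ)⟧' = l (j + 1)) →
        l j ≫ (B.incl j)⟦(1 : ℤ)⟧' = l (j + 1)) ∧
      (x = 0 → ∀ j ≤ m, l j = 0) := by
  choose c hc₀ hc using fun j => exists_choice_extending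
    (fun (y : W ⟶ (B.obj (j + 1))⟦(1 : ℤ)⟧) l => l ≫ (B.incl j)⟦(1 : ℤ)⟧' = y) 0 0
  obtain ⟨l, hlm, hl⟩ :=
    exists_descending_sequence (X := fun j => W ⟶ (B.obj j)⟦(1 : ℤ)⟧) c x
  refine ⟨l, hlm, fun j hj h => ?_, fun hx j hj => ?_⟩
  · rw [hl j hj]
    exact hc j _ h
  · induction hj using Nat.decreasingInduction with
    | self => rw [hlm, hx]
    | of_succ j hj ih => rw [hl j hj, ih, hc₀ j zero_comp]

theorem IsFilteredMap.exists_extension_sequence {g : ∀ m, A.obj m ⟶ B.obj m} {b : ℕ}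
    (hg : IsFilteredMap φ A B g b) :
    ∃ e : ∀ m, A.obj m ⟶ B.obj m,
      (∀ m, (∃ a, IsExtension φ A B m (e m) a) → IsExtension φ A B m (e m) (e (m + 1))) ∧
      ∀ m, n ≤ m → m ≤ b → e m = g m := by
  choose c hc₀ hc using fun m => exists_choice_extending (IsExtension φ A B m) (g m) (g (m + 1))
  refine ⟨fun m => Nat.rec (g 0) c m, fun m => hc m _, fun m hm => ?_⟩
  induction m, hm using Nat.le_induction with
  | base => exact fun _ => A.isZero.eq_of_src _ _
  | succ m hm ih =>
    intro hmb
    exact (congrArg (c m) (ih (by omega))).trans (hc₀ m (hg m hm (by omega)))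

theorem IsFilteredMap.exists_nullhomotopySystem {g : ∀ m, A.obj m ⟶ B.obj m} {b : ℕ}
    (hg : IsFilteredMap φ A B g b) :
    ∃ S : NullhomotopySystem φ A B, ∀ m j, n ≤ m → m < b → j ≤ m → S.lift m j = 0 := by
  obtain ⟨e, he, heg⟩ := hg.exists_extension_sequence
  choose l hself hspec hzero using fun m => B.exists_iterated_lift (attachingDefect φ A B e m)
  refine ⟨{ ext := e, lift := l, lift_self := fun m _ => hself m
            lift_spec := fun m j _ hjm => hspec m j hjm
            ext_spec := fun m _ => he m }, fun m j hm hmb => hzero m ?_ j⟩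
  rw [← exists_isExtension_iff e hm, heg m hm hmb.le]
  exact ⟨_, hg m hm hmb⟩

theorem exists_isFilteredMap_iff (b : ℕ) :
    (∃ g, IsFilteredMap φ A B g b) ↔ ∃ S : NullhomotopySystem φ A B,
      ∀ N i, 2 ≤ N → n ≤ i → i + N < b → S.toda N i = 0 := by
  constructor
  · rintro ⟨g, hg⟩
    obtain ⟨S, hS⟩ := hg.exists_nullhomotopySystem
    refine ⟨S, fun N i hN hi hb => ?_⟩
    rw [NullhomotopyData.toda_eq_zero_iff, hS _ _ (by omega) hb (by omega), zero_comp]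
  · rintro ⟨S, hS⟩
    exact ⟨S.ext, S.isFilteredMap hS⟩

theorem IsExtension.isIso {m : ℕ} (hm : n ≤ m) {a : A.obj m ⟶ B.obj m}
    {b : A.obj (m + 1) ⟶ B.obj (m + 1)} (h : IsExtension φ A B m a b) [IsIso a]
    [IsIso (φ.f m)] : IsIso b :=
  let F : Triangle.mk (A.incl m) (A.proj m) (A.bd m) ⟶
      Triangle.mk (B.incl m) (B.proj m) (B.bd m) :=
    { hom₁ := a, hom₂ := b, hom₃ := cellMap φ m, comm₁ := h.1, comm₂ := h.2.1, comm₃ := h.2.2 }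
  isIso₂_of_isIso₁₃ F (A.dist m hm) (B.dist m hm) ‹IsIso a›
    (Functor.map_isIso (shiftFunctor 𝒯 _) (φ.f m))

theorem IsFilteredMap.isIso {g : ∀ m, A.obj m ⟶ B.obj m} {b : ℕ}
    (hg : IsFilteredMap φ A B g b) (hφ : ∀ i, n ≤ i → i < b → IsIso (φ.f i)) {m : ℕ}
    (hm : n ≤ m) (hmb : m ≤ b) : IsIso (g m) := by
  induction m, hm using Nat.le_induction with
  | base => exact ⟨0, A.isZero.eq_of_src _ _, B.isZero.eq_of_src _ _⟩
  | succ m hm ih =>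
    have : IsIso (g m) := ih (by omega)
    have : IsIso (φ.f m) := hφ m hm hmb
    exact (hg m hm hmb).isIso hm

end Maps

end Pretriangulated

end TotObstruction

theorem mainTheorem2_general {𝒯 : Type u} [Category.{v} 𝒯] [HasZeroObject 𝒯] [HasShift 𝒯 ℤ]
    [Preadditive 𝒯] [∀ n : ℤ, (shiftFunctor 𝒯 n).Additive] [Pretriangulated 𝒯]
    {K L : ChainComplex 𝒯 ℕ} (φ : K ⟶ L) :
    (∀ (n k : ℕ) (A : CellTower K n) (B : CellTower L n),
      ((∃ g, IsFilteredMap φ A B g (n + k)) ↔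
        ∃ S : NullhomotopySystem φ A B,
          ∀ N i : ℕ, 2 ≤ N → N < k → n ≤ i → N + i < n + k → S.toda N i = 0) ∧
      (∀ S : NullhomotopySystem φ A B,
          (∀ N i : ℕ, 2 ≤ N → N < k → n ≤ i → N + i ≤ n + k → S.toda N i = 0) →
          S.IsDefined k n)) ∧
    (∀ (A : CellTower K 0) (B : CellTower L 0) (H : HomotopyColimit A.incl)
        (H' : HomotopyColimit B.incl),
      (∃ S : NullhomotopySystem φ A B, ∀ N i : ℕ, 2 ≤ N → S.toda N i = 0) →
      ∃ (g : ∀ m, A.obj m ⟶ B.obj m) (G : H.pt ⟶ H'.pt),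
        (∀ b, IsFilteredMap φ A B g b) ∧ ∀ m, H.ι m ≫ G = g m ≫ H'.ι m) ∧
    (∀ (n b : ℕ) (A : CellTower K n) (B : CellTower L n) (g : ∀ m, A.obj m ⟶ B.obj m),
      (∀ i, n ≤ i → i < b → IsIso (φ.f i)) → IsFilteredMap φ A B g b →
      ∀ m, n ≤ m → m ≤ b → IsIso (g m)) := by
  refine ⟨fun n k A B => ⟨?_, fun S hS => ?_⟩, ?_,
    fun _ _ _ _ _ hφ hg _ hm hmb => hg.isIso hφ hm hmb⟩
  · rw [exists_isFilteredMap_iff]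
    exact exists_congr fun S => ⟨fun h N i hN _ hi hb => h N i hN hi (by omega),
      fun h N i hN hi hb => h N i hN (by omega) hi (by omega)⟩
  · exact S.isDefined le_rfl (fun N i hN hi _ => hS N i hN (by omega) hi (by omega))
      fun N i hN hi _ => hS N i hN (by omega) hi.le (by omega)
  · rintro A B H H' ⟨S, hS⟩
    have hfiltered (b : ℕ) : IsFilteredMap φ A B S.ext b :=
      S.isFilteredMap fun N i hN _ _ => hS N i hN
    obtain ⟨G, hG⟩ := H.exists_map H' S.ext fun m =>
      (hfiltered (m + 1) m m.zero_le m.lt_succ_self).1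
    exact ⟨S.ext, G, hfiltered, hG⟩

theorem mainTheorem2 {𝒯 : Type u} [Category.{v} 𝒯] [HasZeroObject 𝒯] [HasShift 𝒯 ℤ]
    [Preadditive 𝒯] [∀ n : ℤ, (shiftFunctor 𝒯 n).Additive] [Pretriangulated 𝒯]
    [IsTriangulated 𝒯] (C D : SimplicialObject 𝒯) (f : C ⟶ D)
    (TC : Totalization C) (TD : Totalization D) :
    -- extensions to the subquotients with cells in degrees `n, …, n + k - 1`
    (∀ (n k : ℕ) (A : GrTower TC.tower n) (B : GrTower TD.tower n),
      3 ≤ k →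
      ((∃ g, IsFilteredMap ((alternatingFaceMapComplex 𝒯).map f)
            A.toCellTower B.toCellTower g (n + k)) ↔
        ∃ S : NullhomotopySystem ((alternatingFaceMapComplex 𝒯).map f)
            A.toCellTower B.toCellTower,
          ∀ N i : ℕ, 2 ≤ N → N < k → n ≤ i → N + i < n + k → S.toda N i = 0) ∧
      (∀ S : NullhomotopySystem ((alternatingFaceMapComplex 𝒯).map f)
            A.toCellTower B.toCellTower,
          (∀ N i : ℕ, 2 ≤ N → N < k → n ≤ i → N + i ≤ n + k → S.toda N i = 0) →
          S.IsDefined k n)) ∧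
    -- the map on the whole totalization
    ((∃ S : NullhomotopySystem ((alternatingFaceMapComplex 𝒯).map f)
          TC.tower TD.tower,
        ∀ N i : ℕ, 2 ≤ N → S.toda N i = 0) →
      ∃ (g : ∀ m, TC.tower.obj m ⟶ TD.tower.obj m) (G : TC.tot ⟶ TD.tot),
        (∀ b, IsFilteredMap ((alternatingFaceMapComplex 𝒯).map f)
          TC.tower TD.tower g b) ∧
        ∀ m, TC.ι m ≫ G = g m ≫ TD.ι m) ∧
    -- weak equivalences
    ((∀ m : ℕ, IsIso (f.app (op ⦋m⦌))) →
      (∀ (n k : ℕ) (A : GrTower TC.tower n)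
        (B : GrTower TD.tower n) (g : ∀ m, A.obj m ⟶ B.obj m),
        IsFilteredMap ((alternatingFaceMapComplex 𝒯).map f)
          A.toCellTower B.toCellTower g (n + k) →
        ∀ m, n ≤ m → m ≤ n + k → IsIso (g m)) ∧
      (∀ (b : ℕ) (g : ∀ m, TC.tower.obj m ⟶ TD.tower.obj m),
        IsFilteredMap ((alternatingFaceMapComplex 𝒯).map f)
          TC.tower TD.tower g b →
        ∀ m, m ≤ b → IsIso (g m))) := by
  obtain ⟨hsub, htot, hiso⟩ := mainTheorem2_general ((alternatingFaceMapComplex 𝒯).map f)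
  exact ⟨fun n k A B _ => hsub n k A.toCellTower B.toCellTower,
    htot TC.tower TD.tower TC.homotopyColimit TD.homotopyColimit, fun hf =>
      ⟨fun n k A B g => hiso n (n + k) A.toCellTower B.toCellTower g fun _ _ _ => hf _,
        fun b g hg m => hiso 0 b TC.tower TD.tower g (fun _ _ _ => hf _) hg m m.zero_le⟩⟩
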